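/- Work in the propositional language $\{\wedge,\vee,\cdot,\to,0,1\}$ with countably many variables and put $\neg\varphi:=\varphi\to 0$. Let $\mathbf{FL_e}$ be the external consequence relation of the Full Lambek sequent calculus with exchange ($\Phi\vdash\psi$ iff the sequent $\Rightarrow\psi$ is derivable from the sequents $\Rightarrow\varphi$, $\varphi\in\Phi$). A *substructural logic* is an axiomatic extension of $\mathbf{FL_e}$; logics are ordered by inclusion of consequence relations. $\mathbf{FL_{ew}}$ is $\mathbf{FL_e}$ with left and right weakening, $\mathbf{IPL}$ and $\mathbf{CPL}$ are intuitionistic and classical propositional logic. $\mathbf{G_{FL_e}}(\mathbf{CPL})$ is the least substructural logic $\mathbf K$ such that, for every formula $\varphi$, $\vdash_{\mathbf{CPL}}\varphi$ iff $\vdash_{\mathbf K}\neg\neg\varphi$, and $\mathbf{G_{FL_{ew}}}(\mathbf{CPL})$ is the join of $\mathbf{G_{FL_e}}(\mathbf{CPL})$ and $\mathbf{FL_{ew}}$ in the lattice of substructural logics. An $\mathrm{FL_e}$-algebra is a commutative residuated lattice $\langle A,\wedge,\vee,\cdot,\to,1\rangle$ with an arbitrary constant $0$. For a substructural logic $\mathbf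 L$, let $\mathsf V(\mathbf L)$ be the class of $\mathrm{FL_e}$-algebras satisfying $1\le\varphi$ for every theorem $\varphi$ of $\mathbf L$. Consider the two connectives $$x\Rightarrow^{\wedge}y:=(x\to y)\wedge(y\to\neg\neg x),\qquad x\Rightarrow^{\circ}y:=(x\to y)\cdot(y\to\neg\neg x).$$ For ${\Rightarrow}\in\{\Rightarrow^{\wedge},\Rightarrow^{\circ}\}$: * $(\mathbf L,\Rightarrow)$ is *connexive* if every $\mathbf A\in\mathsf V(\mathbf L)$ satisfies, for all $x,y$, $1\le\neg(x\Rightarrow\neg x)$, $1\le\neg(\neg x\Rightarrow x)$, $1\le(x\Rightarrow y)\Rightarrow\neg(x\Rightarrow\neg y)$ and $1\le(x\Rightarrow\neg y)\Rightarrow\neg(x\Rightarrow y)$, and some $\mathbf A\in\mathsf V(\mathbf L)$ has $x,y$ with $x\Rightarrow y\ne y\Rightarrow x$. * $(\mathbf L,\Rightarrow)$ is *strongly connexive* if it is connexive and, calling the nontrivial members of $\mathsf V(\mathbf L)$ models and a formula $\varphi$ true under a valuation $v$ if $1\le v(\varphi)$: (K1) for all formulas $\varphi$, neither $\varphi\Rightarrow\neg\varphi$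 nor $\neg\varphi\Rightarrow\varphi$ is true under any valuation in any model; (K2) for all formulas $\varphi,\psi$, $\varphi\Rightarrow\psi$ and $\varphi\Rightarrow\neg\psi$ are not both true under any valuation in any model. * $(\mathbf L,\Rightarrow)$ is *weakly connexive* if for all formulas $\varphi,\psi$: $\vdash_{\mathbf L}\neg(\varphi\Rightarrow\neg\varphi)$, $\vdash_{\mathbf L}\neg(\neg\varphi\Rightarrow\varphi)$, $\varphi\Rightarrow\psi\vdash_{\mathbf L}\neg(\varphi\Rightarrow\neg\psi)$ and $\varphi\Rightarrow\neg\psi\vdash_{\mathbf L}\neg(\varphi\Rightarrow\psi)$. **Theorem.** Let ${\Rightarrow}\in\{\Rightarrow^{\circ},\Rightarrow^{\wedge}\}$. For every substructural logic $\mathbf L$ with $\mathbf{FL_{ew}}\subseteq\mathbf L\subseteq\mathbf{IPL}$, the following are equivalent: $(\mathbf L,\Rightarrow)$ is strongly connexive; $(\mathbf L,\Rightarrow)$ is connexive; $(\mathbf L,\Rightarrow)$ is weakly connexive. Moreover, every substructural logic $\mathbf L$ with $\mathbf{G_{FL_{ew}}}(\mathbf{CPL})\subseteq\mathbf L\subseteq\mathbf{IPL}$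 is strongly connexive for $\Rightarrow$. -/

import Mathlib

universe u

namespace Substructural

/-! ### Formulas, sequents, logics -/

/-- Formulas over the language `{∧, ∨, ·, →, 0, 1}` with countably many variables. -/
inductive Fm : Type
  | var : ℕ → Fm
  | and : Fm → Fm → Fm
  | or : Fm → Fm → Fm
  | fus : Fm → Fm → Fm
  | imp : Fm → Fm → Fm
  | zero : Fm
  | one : Fm

namespace Fm

/-- Negation `¬φ := φ → 0`. -/
def neg (φ : Fm) : Fm := φ.imp zero

/-- Uniform substitution. -/
def subst (σ : ℕ → Fm) : Fm → Fm
  | var n => σ n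
  | and φ ψ => and (φ.subst σ) (ψ.subst σ)
  | or φ ψ => or (φ.subst σ) (ψ.subst σ)
  | fus φ ψ => fus (φ.subst σ) (ψ.subst σ)
  | imp φ ψ => imp (φ.subst σ) (ψ.subst σ)
  | zero => zero
  | one => one

theorem subst_var (φ : Fm) : φ.subst var = φ := by
  induction φ <;> simp_all [subst]

theorem subst_subst (σ τ : ℕ → Fm) (φ : Fm) :
    (φ.subst σ).subst τ = φ.subst (fun n => (σ n).subst τ) := by
  induction φ <;> simp_all [subst]

end Fm

/-- Which of the structural rules left weakening, right weakening and contraction are admitted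
on top of exchange. -/
structure StructRules where
  weakL : Prop
  weakR : Prop
  contr : Prop

/-- `Derives R Φ Γ Θ`: the sequent `Γ ⇒ Θ` (a multiset of formulas on the left, at most one formula
on the right) is derivable from the sequents `⇒ φ` with `φ ∈ Φ` in the Full Lambek calculus with
exchange, extended by the structural rules in `R`. -/
inductive Derives (R : StructRules) (Φ : Set Fm) : Multiset Fm → Option Fm → Prop
  | hyp {φ : Fm} : φ ∈ Φ → Derives R Φ 0 (some φ)
  | id (φ : Fm) : Derives R Φ {φ} (some φ)
  | cut {Γ Δ : Multiset Fm} {φ : Fm} {Θ : Option Fm} :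
      Derives R Φ Γ (some φ) → Derives R Φ (φ ::ₘ Δ) Θ → Derives R Φ (Γ + Δ) Θ
  | oneL {Γ : Multiset Fm} {Θ : Option Fm} :
      Derives R Φ Γ Θ → Derives R Φ (Fm.one ::ₘ Γ) Θ
  | oneR : Derives R Φ 0 (some Fm.one)
  | zeroL : Derives R Φ {Fm.zero} none
  | zeroR {Γ : Multiset Fm} : Derives R Φ Γ none → Derives R Φ Γ (some Fm.zero)
  | fusL {Γ : Multiset Fm} {φ ψ : Fm} {Θ : Option Fm} :
      Derives R Φ (φ ::ₘ ψ ::ₘ Γ) Θ → Derives R Φ (φ.fus ψ ::ₘ Γ) Θ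
  | fusR {Γ Δ : Multiset Fm} {φ ψ : Fm} :
      Derives R Φ Γ (some φ) → Derives R Φ Δ (some ψ) → Derives R Φ (Γ + Δ) (some (φ.fus ψ))
  | impL {Γ Δ : Multiset Fm} {φ ψ : Fm} {Θ : Option Fm} :
      Derives R Φ Γ (some φ) → Derives R Φ (ψ ::ₘ Δ) Θ →
        Derives R Φ (φ.imp ψ ::ₘ (Γ + Δ)) Θ
  | impR {Γ : Multiset Fm} {φ ψ : Fm} :
      Derives R Φ (φ ::ₘ Γ) (some ψ) → Derives R Φ Γ (some (φ.imp ψ))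
  | andL₁ {Γ : Multiset Fm} {φ ψ : Fm} {Θ : Option Fm} :
      Derives R Φ (φ ::ₘ Γ) Θ → Derives R Φ (φ.and ψ ::ₘ Γ) Θ
  | andL₂ {Γ : Multiset Fm} {φ ψ : Fm} {Θ : Option Fm} :
      Derives R Φ (ψ ::ₘ Γ) Θ → Derives R Φ (φ.and ψ ::ₘ Γ) Θ
  | andR {Γ : Multiset Fm} {φ ψ : Fm} :
      Derives R Φ Γ (some φ) → Derives R Φ Γ (some ψ) → Derives R Φ Γ (some (φ.and ψ))
  | orL {Γ : Multiset Fm} {φ ψ : Fm} {Θ : Option Fm} :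
      Derives R Φ (φ ::ₘ Γ) Θ → Derives R Φ (ψ ::ₘ Γ) Θ → Derives R Φ (φ.or ψ ::ₘ Γ) Θ
  | orR₁ {Γ : Multiset Fm} {φ ψ : Fm} :
      Derives R Φ Γ (some φ) → Derives R Φ Γ (some (φ.or ψ))
  | orR₂ {Γ : Multiset Fm} {φ ψ : Fm} :
      Derives R Φ Γ (some ψ) → Derives R Φ Γ (some (φ.or ψ))
  | weakL {Γ : Multiset Fm} {φ : Fm} {Θ : Option Fm} :
      R.weakL → Derives R Φ Γ Θ → Derives R Φ (φ ::ₘ Γ) Θ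
  | weakR {Γ : Multiset Fm} {φ : Fm} :
      R.weakR → Derives R Φ Γ none → Derives R Φ Γ (some φ)
  | contr {Γ : Multiset Fm} {φ : Fm} {Θ : Option Fm} :
      R.contr → Derives R Φ (φ ::ₘ φ ::ₘ Γ) Θ → Derives R Φ (φ ::ₘ Γ) Θ

/-- Derivability is transported along maps of the hypotheses, along substitutions and along
stronger structural rules. -/
theorem Derives.transport {R S : StructRules} {Φ Ψ : Set Fm} (σ : ℕ → Fm)
    (hyps : ∀ φ ∈ Φ, Derives S Ψ 0 (some (φ.subst σ)))
    (hwl : R.weakL → ∀ (Γ : Multiset Fm) (φ : Fm) (Θ : Option Fm),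
      Derives S Ψ Γ Θ → Derives S Ψ (φ ::ₘ Γ) Θ)
    (hwr : R.weakR → ∀ (Γ : Multiset Fm) (φ : Fm), Derives S Ψ Γ none → Derives S Ψ Γ (some φ))
    (hc : R.contr → ∀ (Γ : Multiset Fm) (φ : Fm) (Θ : Option Fm),
      Derives S Ψ (φ ::ₘ φ ::ₘ Γ) Θ → Derives S Ψ (φ ::ₘ Γ) Θ)
    {Γ : Multiset Fm} {Θ : Option Fm} (h : Derives R Φ Γ Θ) :
    Derives S Ψ (Γ.map (Fm.subst σ)) (Θ.map (Fm.subst σ)) := by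
  induction h with
  | hyp h => simpa using hyps _ h
  | id φ => simpa using Derives.id _
  | cut _ _ ih₁ ih₂ =>
    simp only [Multiset.map_add, Multiset.map_cons, Option.map_some] at ih₁ ih₂ ⊢
    exact ih₁.cut ih₂
  | oneL _ ih => simpa [Fm.subst] using ih.oneL
  | oneR => simpa [Fm.subst] using Derives.oneR
  | zeroL => simpa [Fm.subst] using Derives.zeroL
  | zeroR _ ih => simpa [Fm.subst] using ih.zeroR
  | fusL _ ih =>
    simp only [Multiset.map_cons, Fm.subst] at ih ⊢
    exact ih.fusL
  | fusR _ _ ih₁ ih₂ =>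
    simp only [Multiset.map_add, Option.map_some, Fm.subst] at ih₁ ih₂ ⊢
    exact ih₁.fusR ih₂
  | impL _ _ ih₁ ih₂ =>
    simp only [Multiset.map_add, Multiset.map_cons, Option.map_some, Fm.subst] at ih₁ ih₂ ⊢
    exact ih₁.impL ih₂
  | impR _ ih =>
    simp only [Multiset.map_cons, Option.map_some, Fm.subst] at ih ⊢
    exact ih.impR
  | andL₁ _ ih =>
    simp only [Multiset.map_cons, Fm.subst] at ih ⊢
    exact ih.andL₁
  | andL₂ _ ih =>
    simp only [Multiset.map_cons, Fm.subst] at ih ⊢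
    exact ih.andL₂
  | andR _ _ ih₁ ih₂ =>
    simp only [Option.map_some, Fm.subst] at ih₁ ih₂ ⊢
    exact ih₁.andR ih₂
  | orL _ _ ih₁ ih₂ =>
    simp only [Multiset.map_cons, Fm.subst] at ih₁ ih₂ ⊢
    exact ih₁.orL ih₂
  | orR₁ _ ih =>
    simp only [Option.map_some, Fm.subst] at ih ⊢
    exact ih.orR₁
  | orR₂ _ ih =>
    simp only [Option.map_some, Fm.subst] at ih ⊢
    exact ih.orR₂
  | weakL r _ ih =>
    simp only [Multiset.map_cons]
    exact hwl r _ _ _ ih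
  | weakR r _ ih =>
    simp only [Option.map_some, Option.map_none] at ih ⊢
    exact hwr r _ _ ih
  | contr r _ ih =>
    simp only [Multiset.map_cons] at ih ⊢
    exact hc r _ _ _ ih

/-- The same without substitution. -/
theorem Derives.transport' {R S : StructRules} {Φ Ψ : Set Fm}
    (hyps : ∀ φ ∈ Φ, Derives S Ψ 0 (some φ))
    (hwl : R.weakL → ∀ (Γ : Multiset Fm) (φ : Fm) (Θ : Option Fm),
      Derives S Ψ Γ Θ → Derives S Ψ (φ ::ₘ Γ) Θ)
    (hwr : R.weakR → ∀ (Γ : Multiset Fm) (φ : Fm), Derives S Ψ Γ none → Derives S Ψ Γ (some φ))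
    (hc : R.contr → ∀ (Γ : Multiset Fm) (φ : Fm) (Θ : Option Fm),
      Derives S Ψ (φ ::ₘ φ ::ₘ Γ) Θ → Derives S Ψ (φ ::ₘ Γ) Θ)
    {Γ : Multiset Fm} {Θ : Option Fm} (h : Derives R Φ Γ Θ) : Derives S Ψ Γ Θ := by
  have hid : Fm.subst Fm.var = _root_.id := funext Fm.subst_var
  have := Derives.transport (S := S) (Ψ := Ψ) Fm.var
    (fun φ hφ => by simpa [Fm.subst_var] using hyps φ hφ) hwl hwr hc h
  simpa [hid] using this

/-- A logic: a structural consequence relation on formulas. -/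
@[ext]
structure Logic where
  entails : Set Fm → Fm → Prop
  refl : ∀ {Φ : Set Fm} {φ : Fm}, φ ∈ Φ → entails Φ φ
  mono : ∀ {Φ Ψ : Set Fm} {φ : Fm}, Φ ⊆ Ψ → entails Φ φ → entails Ψ φ
  trans : ∀ {Φ Ψ : Set Fm} {φ : Fm}, (∀ ψ ∈ Ψ, entails Φ ψ) → entails Ψ φ → entails Φ φ
  structural : ∀ {Φ : Set Fm} {φ : Fm} (σ : ℕ → Fm),
    entails Φ φ → entails (Fm.subst σ '' Φ) (φ.subst σ)

/-- Logics are ordered by inclusion of the consequence relations. -/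
instance : PartialOrder Logic where
  le K L := ∀ (Φ : Set Fm) (φ : Fm), K.entails Φ φ → L.entails Φ φ
  le_refl _ _ _ h := h
  le_trans _ _ _ h₁ h₂ Φ φ h := h₂ Φ φ (h₁ Φ φ h)
  le_antisymm _ _ h₁ h₂ := Logic.ext (funext fun Φ => funext fun φ => propext ⟨h₁ Φ φ, h₂ Φ φ⟩)

namespace Logic

/-- `φ` is a theorem of `L`. -/
def Thm (L : Logic) (φ : Fm) : Prop := L.entails ∅ φ

/-- All substitution instances of the formulas in `Ax`. -/
def instances (Ax : Set Fm) : Set Fm := {χ | ∃ α ∈ Ax, ∃ σ : ℕ → Fm, χ = α.subst σ}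

/-- The axiomatic extension of `L` by the axiom schemes `Ax`. -/
def axExt (L : Logic) (Ax : Set Fm) : Logic where
  entails Φ φ := L.entails (Φ ∪ instances Ax) φ
  refl h := L.refl (Or.inl h)
  mono h := L.mono (Set.union_subset_union_left _ h)
  trans h₁ h₂ := L.trans (fun ψ hψ => hψ.elim (fun h => h₁ ψ h) (fun h => L.refl (Or.inr h))) h₂
  structural σ h := by
    refine L.mono ?_ (L.structural σ h)
    rw [Set.image_union]
    refine Set.union_subset_union_right _ ?_
    rintro _ ⟨_, ⟨α, hα, τ, rfl⟩, rfl⟩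
    exact ⟨α, hα, _, Fm.subst_subst τ σ α⟩

end Logic

/-- The external consequence relation of the calculus with structural rules `R`:
`φ` follows from `Φ` iff the sequent `⇒ φ` is derivable from the sequents `⇒ χ`, `χ ∈ Φ`. -/
def extLogic (R : StructRules) : Logic where
  entails Φ φ := Derives R Φ 0 (some φ)
  refl h := Derives.hyp h
  mono h := Derives.transport' (fun _ hφ => Derives.hyp (h hφ))
    (fun r _ _ _ => Derives.weakL r) (fun r _ _ => Derives.weakR r)
    (fun r _ _ _ => Derives.contr r)
  trans h := Derives.transport' h
    (fun r _ _ _ => Derives.weakL r) (fun r _ _ => Derives.weakR r)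
    (fun r _ _ _ => Derives.contr r)
  structural σ h := Derives.transport σ (fun _ hφ => Derives.hyp (Set.mem_image_of_mem _ hφ))
    (fun r _ _ _ => Derives.weakL r) (fun r _ _ => Derives.weakR r)
    (fun r _ _ _ => Derives.contr r) h

/-- Full Lambek logic with exchange. -/
def FLe : Logic := extLogic ⟨False, False, False⟩

/-- Full Lambek logic with exchange and (left and right) weakening. -/
def FLew : Logic := extLogic ⟨True, True, False⟩

/-- Intuitionistic propositional logic: all structural rules of the calculus `LJ`. -/
def IPL : Logic := extLogic ⟨True, True, True⟩

/-- Classical propositional logic: intuitionistic logic with excluded middle. -/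
def CPL : Logic := IPL.axExt {(Fm.var 0).or (Fm.var 0).neg}

/-- Substructural logics are the axiomatic extensions of `FLe`. -/
def Logic.IsSubstructural (L : Logic) : Prop := ∃ Ax : Set Fm, L = FLe.axExt Ax

/-- The Glivenko property holds for `K` relative to `L`. -/
def Logic.Glivenko (K L : Logic) : Prop := ∀ φ : Fm, L.Thm φ ↔ K.Thm φ.neg.neg

/-- The least substructural logic with the Glivenko property relative to `L`, obtained
as the meet of all of them in the lattice of substructural logics. -/
def glivenkoFLe (L : Logic) : Logic :=
  FLe.axExt {φ | ∀ K : Logic, K.IsSubstructural → K.Glivenko L → K.Thm φ}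

/-- The join of `K` and `L` in the lattice of substructural logics. -/
def Logic.join (K L : Logic) : Logic := FLe.axExt {φ | K.Thm φ ∨ L.Thm φ}

/-- The Glivenko logic of `K` relative to `L`. -/
def glivenkoLogic (K L : Logic) : Logic := (glivenkoFLe L).join K

/-! ### Sanity facts: the logics above are substructural, the meet above is a least element and
the join above is a join -/

theorem FLe_le_of_isSubstructural {L : Logic} (hL : L.IsSubstructural) : FLe ≤ L := by
  obtain ⟨Ax, rfl⟩ := hL
  exact fun Φ φ h => FLe.mono (Set.subset_union_left) h

theorem Logic.axExt_le {K L : Logic} {Ax : Set Fm} (hKL : K ≤ L) (h : ∀ α ∈ Ax, L.Thm α) :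
    K.axExt Ax ≤ L := by
  intro Φ φ hφ
  refine L.trans ?_ (hKL _ _ hφ)
  rintro ψ (hψ | ⟨α, hα, σ, rfl⟩)
  · exact L.refl hψ
  · exact L.mono (by simp) (L.structural σ (h α hα))

theorem Logic.thm_axExt {K : Logic} {Ax : Set Fm} {α : Fm} (h : α ∈ Ax) : (K.axExt Ax).Thm α :=
  K.refl (Or.inr ⟨α, h, Fm.var, (Fm.subst_var α).symm⟩)

theorem Logic.IsSubstructural.axExt {L : Logic} (hL : L.IsSubstructural) (Ax : Set Fm) :
    (L.axExt Ax).IsSubstructural := by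
  obtain ⟨Ax₀, rfl⟩ := hL
  refine ⟨Ax₀ ∪ Ax, le_antisymm ?_ ?_⟩
  · refine Logic.axExt_le (Logic.axExt_le (fun Φ φ h => FLe.mono Set.subset_union_left h) ?_) ?_
    · exact fun α hα => Logic.thm_axExt (Or.inl hα)
    · exact fun α hα => Logic.thm_axExt (Or.inr hα)
  · have hle : FLe.axExt Ax₀ ≤ (FLe.axExt Ax₀).axExt Ax :=
      fun Φ φ h => (FLe.axExt Ax₀).mono Set.subset_union_left h
    refine Logic.axExt_le (fun Φ φ h => hle _ _ (FLe.mono Set.subset_union_left h)) ?_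
    rintro α (hα | hα)
    · exact hle _ _ (Logic.thm_axExt hα)
    · exact Logic.thm_axExt hα

theorem Derives.mp {R : StructRules} {Φ : Set Fm} {φ ψ : Fm}
    (h : Derives R Φ 0 (some (φ.imp ψ))) : Derives R Φ {φ} (some ψ) := by
  have h₁ : Derives R Φ (φ.imp ψ ::ₘ ({φ} + 0)) (some ψ) := (Derives.id φ).impL (Derives.id ψ)
  simpa using h.cut h₁

theorem extLogic_isSubstructural (R : StructRules) : (extLogic R).IsSubstructural := by
  let p := Fm.var 0
  let Ax : Set Fm := {α | (R.weakL ∧ α = p.imp Fm.one) ∨ (R.weakR ∧ α = Fm.zero.imp p) ∨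
    (R.contr ∧ α = p.imp (p.fus p))}
  have hFLe : FLe ≤ extLogic R := fun Φ φ => Derives.transport' (fun _ hφ => Derives.hyp hφ)
    (fun r => False.elim r) (fun r => False.elim r) (fun r => False.elim r)
  refine ⟨Ax, le_antisymm ?_ (Logic.axExt_le hFLe ?_)⟩
  · intro Φ φ
    refine Derives.transport' (fun _ hφ => Derives.hyp (Or.inl hφ)) ?_ ?_ ?_
    · intro r Γ φ Θ h
      have h₁ : Derives ⟨False, False, False⟩ (Φ ∪ Logic.instances Ax) 0
          (some (φ.imp Fm.one)) :=
        Derives.hyp (Or.inr ⟨_, Or.inl ⟨r, rfl⟩, fun _ => φ, rfl⟩)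
      rw [← Multiset.singleton_add]
      exact h₁.mp.cut h.oneL
    · intro r Γ φ h
      have h₁ : Derives ⟨False, False, False⟩ (Φ ∪ Logic.instances Ax) 0
          (some (Fm.zero.imp φ)) :=
        Derives.hyp (Or.inr ⟨_, Or.inr (Or.inl ⟨r, rfl⟩), fun _ => φ, rfl⟩)
      simpa using h.zeroR.cut (Δ := 0) h₁.mp
    · intro r Γ φ Θ h
      have h₁ : Derives ⟨False, False, False⟩ (Φ ∪ Logic.instances Ax) 0
          (some (φ.imp (φ.fus φ))) :=
        Derives.hyp (Or.inr ⟨_, Or.inr (Or.inr ⟨r, rfl⟩), fun _ => φ, rfl⟩)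
      rw [← Multiset.singleton_add]
      exact h₁.mp.cut h.fusL
  · rintro α (⟨r, rfl⟩ | ⟨r, rfl⟩ | ⟨r, rfl⟩)
    · exact Derives.impR (Derives.weakL r Derives.oneR)
    · exact Derives.impR (Derives.weakR r Derives.zeroL)
    · exact Derives.impR (Derives.contr r ((Derives.id p).fusR (Derives.id p)))

theorem CPL_isSubstructural : CPL.IsSubstructural :=
  (extLogic_isSubstructural _).axExt _

theorem glivenko_CPL_CPL : CPL.Glivenko CPL := by
  intro φ
  let Φ : Set Fm := ∅ ∪ Logic.instances {(Fm.var 0).or (Fm.var 0).neg}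
  have hem : Derives ⟨True, True, True⟩ Φ 0 (some (φ.or φ.neg)) :=
    Derives.hyp (Or.inr ⟨_, rfl, fun _ => φ, rfl⟩)
  constructor
  · intro h
    have h' : Derives ⟨True, True, True⟩ Φ 0 (some φ) := h
    have h₁ : Derives ⟨True, True, True⟩ Φ (φ.neg ::ₘ (0 + 0)) none :=
      h'.impL Derives.zeroL
    rw [zero_add] at h₁
    exact Derives.impR (Derives.zeroR h₁)
  · intro h
    have h' : Derives ⟨True, True, True⟩ Φ 0 (some (φ.neg.imp Fm.zero)) := h
    have h₁ : Derives ⟨True, True, True⟩ Φ {φ.neg} none := by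
      simpa using h'.mp.cut (Δ := 0) Derives.zeroL
    have h₂ : Derives ⟨True, True, True⟩ Φ {φ.neg} (some φ) := Derives.weakR trivial h₁
    have h₃ : Derives ⟨True, True, True⟩ Φ (φ.or φ.neg ::ₘ 0) (some φ) :=
      Derives.orL (Derives.id φ) h₂
    exact (by simpa using hem.cut h₃ : Derives ⟨True, True, True⟩ Φ 0 (some φ))

theorem isLeast_glivenkoFLe_CPL :
    IsLeast {K : Logic | K.IsSubstructural ∧ K.Glivenko CPL} (glivenkoFLe CPL) := by
  have hle : ∀ K : Logic, K.IsSubstructural → K.Glivenko CPL → glivenkoFLe CPL ≤ K :=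
    fun K hK hG => Logic.axExt_le (FLe_le_of_isSubstructural hK) (fun α hα => hα K hK hG)
  refine ⟨⟨⟨_, rfl⟩, fun φ => ⟨fun h => ?_, fun h => ?_⟩⟩, fun K hK => hle K hK.1 hK.2⟩
  · exact Logic.thm_axExt (fun K _ hG => (hG φ).1 h)
  · exact (glivenko_CPL_CPL φ).2 (hle CPL CPL_isSubstructural glivenko_CPL_CPL _ _ h)

theorem isLeast_join {K L : Logic} (hK : K.IsSubstructural) (hL : L.IsSubstructural) :
    IsLeast {M : Logic | M.IsSubstructural ∧ K ≤ M ∧ L ≤ M} (K.join L) := by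
  refine ⟨⟨⟨_, rfl⟩, ?_, ?_⟩, fun M hM => Logic.axExt_le (FLe_le_of_isSubstructural hM.1) ?_⟩
  · obtain ⟨Ax, rfl⟩ := hK
    exact Logic.axExt_le (fun Φ φ h => FLe.mono Set.subset_union_left h)
      (fun α hα => Logic.thm_axExt (Or.inl (Logic.thm_axExt hα)))
  · obtain ⟨Ax, rfl⟩ := hL
    exact Logic.axExt_le (fun Φ φ h => FLe.mono Set.subset_union_left h)
      (fun α hα => Logic.thm_axExt (Or.inr (Logic.thm_axExt hα)))
  · rintro α (h | h)
    · exact hM.2.1 _ _ h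
    · exact hM.2.2 _ _ h

/-! ### Algebras -/

/-- `FLe`-algebras: commutative residuated lattices with an arbitrary constant `0`. -/
class FLeAlgebra (A : Type u) extends Lattice A, CommMonoid A, Zero A where
  /-- the residual `x → y` -/
  res : A → A → A
  residuation : ∀ x y z : A, x * y ≤ z ↔ x ≤ res y z

namespace FLeAlgebra

variable {A : Type u} [FLeAlgebra A]

/-- Negation `¬x := x → 0`. -/
def neg (x : A) : A := res x 0

/-- The value of a formula under a valuation of the variables. -/
def eval (v : ℕ → A) : Fm → A
  | Fm.var n => v n
  | Fm.and φ ψ => eval v φ ⊓ eval v ψ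
  | Fm.or φ ψ => eval v φ ⊔ eval v ψ
  | Fm.fus φ ψ => eval v φ * eval v ψ
  | Fm.imp φ ψ => res (eval v φ) (eval v ψ)
  | Fm.zero => 0
  | Fm.one => 1

end FLeAlgebra

/-- `A` belongs to the variety `V(L)`: it satisfies `1 ≤ φ` for every theorem `φ` of `L`. -/
def InVariety (L : Logic) (A : Type u) [FLeAlgebra A] : Prop :=
  ∀ φ : Fm, L.Thm φ → ∀ v : ℕ → A, 1 ≤ FLeAlgebra.eval v φ

/-! ### Connexivity -/

/-- The two connectives `⇒∧` and `⇒∘`. -/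
inductive Arrow : Type
  | meet
  | circ

namespace Arrow

/-- The connective on formulas: `φ ⇒∧ ψ := (φ → ψ) ∧ (ψ → ¬¬φ)` and
`φ ⇒∘ ψ := (φ → ψ) · (ψ → ¬¬φ)`. -/
def fm : Arrow → Fm → Fm → Fm
  | meet, φ, ψ => (φ.imp ψ).and (ψ.imp φ.neg.neg)
  | circ, φ, ψ => (φ.imp ψ).fus (ψ.imp φ.neg.neg)

/-- The operation that the connective induces on an `FLe`-algebra. -/
def op {A : Type u} [FLeAlgebra A] : Arrow → A → A → A
  | meet, x, y => FLeAlgebra.res x y ⊓ FLeAlgebra.res y (FLeAlgebra.neg (FLeAlgebra.neg x))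
  | circ, x, y => FLeAlgebra.res x y * FLeAlgebra.res y (FLeAlgebra.neg (FLeAlgebra.neg x))

theorem eval_fm {A : Type u} [FLeAlgebra A] (a : Arrow) (v : ℕ → A) (φ ψ : Fm) :
    FLeAlgebra.eval v (a.fm φ ψ) = a.op (FLeAlgebra.eval v φ) (FLeAlgebra.eval v ψ) := by
  cases a <;> rfl

end Arrow

open FLeAlgebra in
/-- `(A, ⇒)` satisfies Aristotle's and Boethius' theses. -/
structure AlgProtoConnexive (A : Type u) [FLeAlgebra A] (a : Arrow) : Prop where
  aristotle₁ : ∀ x : A, 1 ≤ neg (a.op x (neg x))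
  aristotle₂ : ∀ x : A, 1 ≤ neg (a.op (neg x) x)
  boethius₁ : ∀ x y : A, 1 ≤ a.op (a.op x y) (neg (a.op x (neg y)))
  boethius₂ : ∀ x y : A, 1 ≤ a.op (a.op x (neg y)) (neg (a.op x y))

/-- Principle of non-symmetry in `(A, ⇒)`. -/
def AlgNonSymmetric (A : Type u) [FLeAlgebra A] (a : Arrow) : Prop :=
  ∃ x y : A, ¬ a.op x y ≤ a.op y x ∨ ¬ a.op y x ≤ a.op x y

/-- `(L, ⇒)` is connexive: all members of `V(L)` satisfy Aristotle's and Boethius' theses, and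
`⇒` is not symmetric in at least one of them. -/
def Connexive (L : Logic) (a : Arrow) : Prop :=
  (∀ (A : Type u) [FLeAlgebra A], InVariety L A → AlgProtoConnexive A a) ∧
  ∃ (A : Type u) (_ : FLeAlgebra A), InVariety L A ∧ AlgNonSymmetric A a

/-- A formula holds in the `FLe`-algebra `A` under the valuation `v`. -/
def Satisfies {A : Type u} [FLeAlgebra A] (v : ℕ → A) (φ : Fm) : Prop :=
  1 ≤ FLeAlgebra.eval v φ

/-- In no model (nontrivial member of `V(L)`) is a formula `φ ⇒ ¬φ` or `¬φ ⇒ φ` satisfiable. -/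
def K1 (L : Logic) (a : Arrow) : Prop :=
  ∀ (A : Type u) [FLeAlgebra A] [Nontrivial A], InVariety L A → ∀ φ : Fm,
    (¬ ∃ v : ℕ → A, Satisfies v (a.fm φ φ.neg)) ∧ ¬ ∃ v : ℕ → A, Satisfies v (a.fm φ.neg φ)

/-- In no model (nontrivial member of `V(L)`) are formulas `φ ⇒ ψ` and `φ ⇒ ¬ψ`
simultaneously satisfiable. -/
def K2 (L : Logic) (a : Arrow) : Prop :=
  ∀ (A : Type u) [FLeAlgebra A] [Nontrivial A], InVariety L A → ∀ φ ψ : Fm,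
    ¬ ∃ v : ℕ → A, Satisfies v (a.fm φ ψ) ∧ Satisfies v (a.fm φ ψ.neg)

/-- `(L, ⇒)` is strongly connexive. -/
def StronglyConnexive (L : Logic) (a : Arrow) : Prop :=
  Connexive.{u} L a ∧ K1.{u} L a ∧ K2.{u} L a

/-- `(L, ⇒)` is weakly connexive: Aristotle's theses are theorems and the rule forms of
Boethius' theses hold. -/
structure WeaklyConnexive (L : Logic) (a : Arrow) : Prop where
  aristotle₁ : ∀ φ : Fm, L.Thm (a.fm φ φ.neg).neg
  aristotle₂ : ∀ φ : Fm, L.Thm (a.fm φ.neg φ).neg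
  boethius₁ : ∀ φ ψ : Fm, L.entails {a.fm φ ψ} (a.fm φ ψ.neg).neg
  boethius₂ : ∀ φ ψ : Fm, L.entails {a.fm φ ψ.neg} (a.fm φ ψ).neg

end Substructural

open Substructural

namespace Substructural

/-! ### Arithmetic of `FLe`-algebras -/

namespace FLeAlgebra

variable {A : Type u} [FLeAlgebra A] {x y z w : A}

/-! For logics above `FLew` every notion of connexivity reduces to one property of the algebras in
`V(L)`: `x ⊓ neg x ≤ 0` for all `x`, i.e. negation is a pseudocomplementation
(`IsPseudocomplemented`).

Necessity: weak connexivity makes the first Aristotle thesis hold at `x ⊓ neg x`, and this instance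
already forces that element below `0` (`isPseudocomplemented_of_aristotle`).

Sufficiency: under pseudocomplementation `x * x ≤ 0` implies `x ≤ 0`, so contraction and case
distinction are available when proving inequalities `_ ≤ 0`. The theses all come down to such
inequalities and are checked almost classically (`algProtoConnexive`). The strong conditions follow
because a counterexample would give `1 ≤ 0`, which collapses a bounded algebra. Non-symmetry needs
only the three-element Heyting chain, which lies in `V(L)` when `L ≤ IPL`.

The remaining link, from connexive to weakly connexive, is algebraic completeness via the
Lindenbaum–Tarski algebra. For the Glivenko logic, `CPL` proves noncontradiction, so its double
negation is a theorem, and that is pseudocomplementation. -/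

protected theorem mul_le_mul (h₁ : x ≤ y) (h₂ : z ≤ w) : x * z ≤ y * w := by
  have right : ∀ {a b c : A}, a ≤ b → a * c ≤ b * c := fun {a b c} h =>
    (residuation _ _ _).2 (h.trans ((residuation b c (b * c)).1 le_rfl))
  calc x * z ≤ y * z := right h₁
    _ = z * y := mul_comm _ _
    _ ≤ w * y := right h₂
    _ = y * w := mul_comm _ _

theorem one_le_res : 1 ≤ res x y ↔ x ≤ y := by
  rw [← residuation, one_mul]

theorem one_le_neg : 1 ≤ neg x ↔ x ≤ 0 := one_le_res

theorem le_neg : x ≤ neg y ↔ x * y ≤ 0 := (residuation _ _ _).symm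

theorem le_neg_comm : x ≤ neg y ↔ y ≤ neg x := by rw [le_neg, le_neg, mul_comm]

theorem le_neg_neg (x : A) : x ≤ neg (neg x) := le_neg_comm.1 le_rfl

theorem neg_mul_le (x : A) : neg x * x ≤ 0 := le_neg.1 le_rfl

theorem mul_neg_le (x : A) : x * neg x ≤ 0 := le_neg.1 (le_neg_neg x)

theorem neg_neg_neg_le (x : A) : neg (neg (neg x)) ≤ neg x :=
  le_neg_comm.1 ((le_neg_neg x).trans (le_neg_neg _))

/-- The `FLe`-algebra validates weakening: `1` is the top and `0` the bottom element. -/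
structure IsBounded (A : Type u) [FLeAlgebra A] : Prop where
  le_one : ∀ x : A, x ≤ 1
  zero_le : ∀ x : A, 0 ≤ x

/-- The negation of a bounded `FLe`-algebra is a pseudocomplementation. -/
structure IsPseudocomplemented (A : Type u) [FLeAlgebra A] : Prop extends IsBounded A where
  inf_neg_le : ∀ x : A, x ⊓ neg x ≤ 0

/-! ### Consequences of weakening -/

namespace IsBounded

theorem mul_le_left (hA : IsBounded A) (x y : A) : x * y ≤ x := by
  simpa using FLeAlgebra.mul_le_mul (le_refl x) (hA.le_one y)

theorem mul_le_right (hA : IsBounded A) (x y : A) : x * y ≤ y := by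
  rw [mul_comm]; exact hA.mul_le_left y x

theorem mul_le_of_left_le (hA : IsBounded A) (h : x ≤ z) (y : A) : x * y ≤ z := (hA.mul_le_left x y).trans h

theorem mul_le_of_right_le (hA : IsBounded A) (x : A) (h : y ≤ z) : x * y ≤ z := (hA.mul_le_right x y).trans h

theorem le_res (hA : IsBounded A) (x y : A) : y ≤ res x y := (residuation _ _ _).1 (hA.mul_le_left y x)

theorem neg_le_res (hA : IsBounded A) (x y : A) : neg x ≤ res x y :=
  (residuation _ _ _).1 ((neg_mul_le x).trans (hA.zero_le y))

/-- Together with `op_le_res_neg_neg` and `mul_le_op`, this lets most later arguments treat both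
connectives uniformly. -/
theorem op_le_res (hA : IsBounded A) (a : Arrow) (x y : A) : a.op x y ≤ res x y := by
  cases a
  · exact inf_le_left
  · exact hA.mul_le_left _ _

theorem op_le_res_neg_neg (hA : IsBounded A) (a : Arrow) (x y : A) : a.op x y ≤ res y (neg (neg x)) := by
  cases a
  · exact inf_le_right
  · exact hA.mul_le_right _ _

/-- Squaring `z` supplies one copy per factor for fusion; for the meet the spare copy is discarded
by weakening. -/
theorem mul_le_op (hA : IsBounded A) (a : Arrow) (h₁ : z ≤ res x y) (h₂ : z ≤ res y (neg (neg x))) :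
    z * z ≤ a.op x y := by
  cases a
  · exact le_inf (hA.mul_le_of_left_le h₁ z) (hA.mul_le_of_left_le h₂ z)
  · exact FLeAlgebra.mul_le_mul h₁ h₂

theorem one_le_op (hA : IsBounded A) (a : Arrow) (h₁ : x ≤ y) (h₂ : y ≤ neg (neg x)) : 1 ≤ a.op x y := by
  simpa using hA.mul_le_op a (one_le_res.2 h₁) (one_le_res.2 h₂)

/-- The first thesis of Aristotle forces the negation to be a pseudocomplementation. -/
theorem isPseudocomplemented_of_aristotle (hA : IsBounded A) (a : Arrow)
    (h : ∀ x : A, a.op (x ⊓ neg x) (neg (x ⊓ neg x)) ≤ 0) : IsPseudocomplemented A := by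
  refine ⟨hA, fun x => ?_⟩
  have hw := h x
  set w := x ⊓ neg x
  have hww : w ≤ neg w :=
    le_neg.2 ((FLeAlgebra.mul_le_mul inf_le_left inf_le_right).trans (mul_neg_le x))
  -- The first component of `a.op w (neg w)` is therefore trivial, and weakening puts `neg (neg w)`
  -- below the second; hence `w ≤ neg (neg w) ≤ a.op w (neg w) ≤ 0`.
  have h₁ : (1 : A) ≤ res w (neg w) := one_le_res.2 hww
  have h₂ : neg (neg w) ≤ a.op w (neg w) := by
    cases a
    · exact le_inf ((hA.le_one _).trans h₁) (hA.le_res _ _)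
    · exact (one_mul _).symm.le.trans (FLeAlgebra.mul_le_mul h₁ (hA.le_res _ _))
  exact (le_neg_neg w).trans (h₂.trans hw)

end IsBounded

/-! ### Connexive theses from pseudocomplementation -/

namespace IsPseudocomplemented

/-- `x * x ≤ 0` says `x ≤ neg x`, so `x` lies below `x ⊓ neg x`. -/
theorem le_zero_of_mul_self (hA : IsPseudocomplemented A) (h : x * x ≤ 0) : x ≤ 0 :=
  (le_inf le_rfl (le_neg.2 h)).trans (hA.inf_neg_le x)

/-- In a pseudocomplemented algebra, contraction is available below `0`. -/
theorem mul_le_zero_of_mul_mul (hA : IsPseudocomplemented A) (h : x * y * y ≤ 0) : x * y ≤ 0 := by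
  refine hA.le_zero_of_mul_self ?_
  calc x * y * (x * y) = x * (x * y * y) := by ac_rfl
    _ ≤ 0 := hA.mul_le_of_right_le _ h

/-- Case distinction below `0`. -/
theorem le_zero_of_cases (hA : IsPseudocomplemented A) (y : A) (h₁ : x * y ≤ 0) (h₂ : x * neg y ≤ 0) : x ≤ 0 :=
  hA.le_zero_of_mul_self ((FLeAlgebra.mul_le_mul le_rfl (le_neg.2 h₁)).trans h₂)

/-- Let `t` be the product. It sends `x` below both `y` and `neg y`, so `t ≤ neg x`; it sends `y`
below `neg (neg x)`, so also `t ≤ neg y`. But `t` sends `neg y` below `neg (neg x)` too, which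
contradicts `t ≤ neg x` up to powers of `t`. -/
theorem op_mul_op_neg_le (hA : IsPseudocomplemented A) (a : Arrow) (x y : A) : a.op x y * a.op x (neg y) ≤ 0 := by
  have h₁ := hA.mul_le_of_left_le (hA.op_le_res a x y) (a.op x (neg y))
  have h₂ := hA.mul_le_of_left_le (hA.op_le_res_neg_neg a x y) (a.op x (neg y))
  have h₃ := hA.mul_le_of_right_le (a.op x y) (hA.op_le_res a x (neg y))
  have h₄ := hA.mul_le_of_right_le (a.op x y) (hA.op_le_res_neg_neg a x (neg y))
  set t := a.op x y * a.op x (neg y)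
  rw [← residuation] at h₁ h₂ h₃ h₄
  have hx : t ≤ neg x := le_neg.2 <| hA.le_zero_of_mul_self <|
    (FLeAlgebra.mul_le_mul h₁ h₃).trans (mul_neg_le y)
  have hy : t ≤ neg y := le_neg.2 <| hA.le_zero_of_mul_self <|
    (FLeAlgebra.mul_le_mul (hA.mul_le_of_left_le hx y) h₂).trans (mul_neg_le _)
  have htt : t * t ≤ neg (neg x) := (FLeAlgebra.mul_le_mul le_rfl hy).trans h₄
  exact hA.le_zero_of_mul_self <| hA.le_zero_of_mul_self <|
    (FLeAlgebra.mul_le_mul (hA.mul_le_of_left_le hx t) htt).trans (mul_neg_le _)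

/-- A truth-table argument: whichever of `x`, `neg x` and of `y`, `neg y` is assumed, `x` matches
either `y` or `neg y`, and the corresponding arrow holds. -/
theorem neg_op_mul_neg_op_neg_le (hA : IsPseudocomplemented A) (a : Arrow) (x y : A) :
    neg (a.op x y) * neg (a.op x (neg y)) ≤ 0 := by
  have hp : neg (a.op x y) * neg (a.op x (neg y)) * a.op x y ≤ 0 :=
    (FLeAlgebra.mul_le_mul (hA.mul_le_left _ _) le_rfl).trans (neg_mul_le _)
  have hq : neg (a.op x y) * neg (a.op x (neg y)) * a.op x (neg y) ≤ 0 :=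
    (FLeAlgebra.mul_le_mul (hA.mul_le_right _ _) le_rfl).trans (neg_mul_le _)
  set s := neg (a.op x y) * neg (a.op x (neg y))
  -- Here `u` and `v` are the two assumed literals. Since `mul_le_op` consumes `u * v` twice,
  -- contraction below `0` removes the second copy.
  have key : ∀ u v z w : A, s * a.op z w ≤ 0 → u ≤ res z w ∧ v ≤ res w (neg (neg z)) →
      s * u * v ≤ 0 := fun u v z w hs h => by
    have h' : u * v * (u * v) ≤ a.op z w :=
      hA.mul_le_op a (hA.mul_le_of_left_le h.1 v) (hA.mul_le_of_right_le u h.2)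
    rw [mul_assoc]
    refine hA.mul_le_zero_of_mul_mul ?_
    rw [mul_assoc]
    exact (FLeAlgebra.mul_le_mul le_rfl h').trans hs
  have hxx : x ≤ neg (neg x) := le_neg_neg x
  refine hA.le_zero_of_cases x (hA.le_zero_of_cases y ?_ ?_) (hA.le_zero_of_cases y ?_ ?_)
  -- When `x` is assumed, the literal of `y` proves the first implication, so it must come first.
  · rw [mul_right_comm]
    exact key y x x y hp ⟨hA.le_res _ _, hxx.trans (hA.le_res _ _)⟩
  · rw [mul_right_comm]
    exact key (neg y) x x (neg y) hq ⟨hA.le_res _ _, hxx.trans (hA.le_res _ _)⟩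
  · exact key (neg x) y x (neg y) hq
      ⟨hA.neg_le_res _ _, (le_neg_neg y).trans (hA.neg_le_res _ _)⟩
  · exact key (neg x) (neg y) x y hp ⟨hA.neg_le_res _ _, hA.neg_le_res _ _⟩

/-- The first component with contraction gives `a.op x (neg x) ≤ neg x`; feeding this into the
second puts its square below `neg (neg x)`, so its fourth power is below `0`. -/
theorem op_neg_le_zero (hA : IsPseudocomplemented A) (a : Arrow) (x : A) : a.op x (neg x) ≤ 0 := by
  have h₁ : a.op x (neg x) ≤ neg x := by
    refine le_neg.2 (hA.mul_le_zero_of_mul_mul ?_)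
    exact le_neg.1 ((residuation _ _ _).2 (hA.op_le_res a x (neg x)))
  have h₂ := (residuation _ _ _).2 (hA.op_le_res_neg_neg a x (neg x))
  exact hA.le_zero_of_mul_self <| hA.le_zero_of_mul_self <|
    (FLeAlgebra.mul_le_mul (hA.mul_le_of_left_le h₁ _)
      ((FLeAlgebra.mul_le_mul le_rfl h₁).trans h₂)).trans (mul_neg_le _)

/-- As in `op_neg_le_zero`, with the components exchanged: the second one, after collapsing a triple
negation, now yields the bound by `neg x`. -/
theorem neg_op_le_zero (hA : IsPseudocomplemented A) (a : Arrow) (x : A) : a.op (neg x) x ≤ 0 := by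
  have h₁ : a.op (neg x) x ≤ neg x := by
    refine le_neg.2 (hA.mul_le_zero_of_mul_mul ?_)
    exact (FLeAlgebra.mul_le_mul ((residuation _ _ _).2 (hA.op_le_res_neg_neg a (neg x) x)
      |>.trans (neg_neg_neg_le x)) le_rfl).trans (neg_mul_le x)
  have h₂ := (residuation _ _ _).2 (hA.op_le_res a (neg x) x)
  exact hA.le_zero_of_mul_self <| hA.le_zero_of_mul_self <|
    (FLeAlgebra.mul_le_mul (hA.mul_le_of_left_le h₁ _)
      ((FLeAlgebra.mul_le_mul le_rfl h₁).trans h₂)).trans (neg_mul_le _)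

/-- For `p = a.op x y` and `q = a.op x (neg y)`, both Boethius theses amount to `p * q ≤ 0` and `neg
p * neg q ≤ 0`, conditions symmetric in `p` and `q`. -/
theorem algProtoConnexive (hA : IsPseudocomplemented A) (a : Arrow) : AlgProtoConnexive A a where
  aristotle₁ x := one_le_neg.2 (hA.op_neg_le_zero a x)
  aristotle₂ x := one_le_neg.2 (hA.neg_op_le_zero a x)
  boethius₁ x y := hA.one_le_op a (le_neg.2 (hA.op_mul_op_neg_le a x y))
    (le_neg_comm.1 (le_neg.2 (hA.neg_op_mul_neg_op_neg_le a x y)))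
  boethius₂ x y := hA.one_le_op a (le_neg_comm.1 (le_neg.2 (hA.op_mul_op_neg_le a x y)))
    (le_neg.2 (hA.neg_op_mul_neg_op_neg_le a x y))

end IsPseudocomplemented

theorem eval_neg (v : ℕ → A) (φ : Fm) : eval v φ.neg = neg (eval v φ) := rfl

end FLeAlgebra

open FLeAlgebra

/-! ### Heyting algebras -/

/-- A Heyting algebra as an `FLe`-algebra with `·` the meet. -/
abbrev heytingFLeAlgebra (H : Type u) [HeytingAlgebra H] : FLeAlgebra H where
  mul := (· ⊓ ·)
  mul_assoc := inf_assoc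
  mul_comm := inf_comm
  one := ⊤
  one_mul := top_inf_eq
  mul_one := inf_top_eq
  zero := ⊥
  res := (· ⇨ ·)
  residuation _ _ _ := le_himp_iff.symm

section Heyting

variable {H : Type u} [HeytingAlgebra H]

attribute [local instance] heytingFLeAlgebra

theorem Derives.heyting_sound {R : StructRules} {Φ : Set Fm} (v : ℕ → H)
    (hΦ : ∀ φ ∈ Φ, 1 ≤ eval v φ) {Γ : Multiset Fm} {Θ : Option Fm} (h : Derives R Φ Γ Θ) :
    (Γ.map (eval v)).inf ≤ Θ.elim ⊥ (eval v) := by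
  have hmul : ∀ x y : H, x * y = x ⊓ y := fun _ _ => rfl
  have hone : (1 : H) = ⊤ := rfl
  have hzero : (0 : H) = ⊥ := rfl
  have hres : ∀ x y : H, res x y = x ⇨ y := fun _ _ => rfl
  induction h with
  | hyp h => simpa [hone] using hΦ _ h
  | id φ => simp
  | cut _ _ ih₁ ih₂ =>
    simp only [Multiset.map_add, Multiset.inf_add, Multiset.map_cons, Multiset.inf_cons,
      Option.elim_some] at ih₁ ih₂ ⊢
    exact (inf_le_inf_right _ ih₁).trans ih₂
  | oneL _ ih => simpa [eval, hone] using ih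
  | oneR => simp [eval, hone]
  | zeroL => simp [eval, hzero]
  | zeroR _ ih => simpa [eval, hzero] using ih
  | fusL _ ih => simpa [eval, hmul, inf_assoc] using ih
  | fusR _ _ ih₁ ih₂ =>
    simp only [Multiset.map_add, Multiset.inf_add, Option.elim_some, eval, hmul] at ih₁ ih₂ ⊢
    exact inf_le_inf ih₁ ih₂
  | @impL Γ Δ φ ψ Θ _ _ ih₁ ih₂ =>
    simp only [Multiset.map_add, Multiset.inf_add, Multiset.map_cons, Multiset.inf_cons,
      Option.elim_some, eval, hres] at ih₁ ih₂ ⊢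
    refine le_trans ?_ ih₂
    rw [← inf_assoc]
    exact inf_le_inf_right _ ((inf_le_inf_left _ ih₁).trans himp_inf_le)
  | impR _ ih =>
    simp only [Multiset.map_cons, Multiset.inf_cons, Option.elim_some, eval, hres] at ih ⊢
    rwa [le_himp_iff, inf_comm]
  | andL₁ _ ih =>
    simp only [Multiset.map_cons, Multiset.inf_cons, eval] at ih ⊢
    exact (inf_le_inf_right _ inf_le_left).trans ih
  | andL₂ _ ih =>
    simp only [Multiset.map_cons, Multiset.inf_cons, eval] at ih ⊢
    exact (inf_le_inf_right _ inf_le_right).trans ih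
  | andR _ _ ih₁ ih₂ => exact le_inf ih₁ ih₂
  | orL _ _ ih₁ ih₂ =>
    simp only [Multiset.map_cons, Multiset.inf_cons, eval] at ih₁ ih₂ ⊢
    rw [inf_sup_right]
    exact sup_le ih₁ ih₂
  | orR₁ _ ih => exact le_sup_of_le_left ih
  | orR₂ _ ih => exact le_sup_of_le_right ih
  | weakL _ _ ih =>
    simp only [Multiset.map_cons, Multiset.inf_cons]
    exact inf_le_of_right_le ih
  | weakR _ _ ih => exact ih.trans bot_le
  | contr _ _ ih =>
    simp only [Multiset.map_cons, Multiset.inf_cons, ← inf_assoc, inf_idem] at ih ⊢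
    exact ih

theorem inVariety_of_le_IPL {L : Logic} (hL : L ≤ IPL) : InVariety L H := fun φ hφ v => by
  have h : Derives ⟨True, True, True⟩ ∅ 0 (some φ) := hL _ _ hφ
  have h' : ⊤ ≤ eval v φ := h.heyting_sound v (by simp)
  exact h'

end Heyting

/-- The connective `⇒` is not symmetric in the three-element chain. -/
theorem exists_algNonSymmetric {L : Logic} (hL : L ≤ IPL) (a : Arrow) :
    ∃ (A : Type u) (_ : FLeAlgebra A), InVariety L A ∧ AlgNonSymmetric A a := by
  -- The three-element chain, built so as to live in an arbitrary universe. Its middle element `m`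
  -- is dense: `neg (neg m) = ⊤`. Thus `m ⇒ ⊤` is `⊤`, whereas `⊤ ⇒ m` stays below `m`.
  let H := WithTop (WithBot PUnit.{u + 1})
  let _ : HeytingAlgebra H := (LinearOrder.toBiheytingAlgebra H).toHeytingAlgebra
  let m : H := ((PUnit.unit : WithBot PUnit) : H)
  let _ : FLeAlgebra H := heytingFLeAlgebra H
  have hbot : m ≠ ⊥ := fun h => WithBot.coe_ne_bot (WithTop.coe_injective h)
  have htop : m ≠ ⊤ := WithTop.coe_ne_top
  have hneg : mᶜ = ⊥ := (min_eq_bot.1 (inf_compl_self (a := m))).resolve_left hbot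
  have hnn : neg (neg m) = ⊤ := (congrArg compl (show m ⇨ ⊥ = ⊥ by rw [himp_bot, hneg])).trans
    compl_bot
  refine ⟨H, inferInstance, inVariety_of_le_IPL hL, m, ⊤, Or.inl ?_⟩
  have h₁ : a.op m ⊤ = ⊤ := by
    -- Fusion is the meet here, so one computation serves both connectives definitionally.
    have : (m ⇨ ⊤) ⊓ (⊤ ⇨ neg (neg m)) = (⊤ : H) := by rw [hnn, himp_top, himp_top, inf_top_eq]
    cases a <;> exact this
  have h₂ : a.op ⊤ m ≤ m := by
    have : (⊤ ⇨ m) ⊓ (m ⇨ neg (neg ⊤)) ≤ (m : H) := inf_le_of_left_le top_himp.le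
    cases a <;> exact this
  intro h
  exact htop (top_le_iff.1 (h₁ ▸ h.trans h₂))

/-! ### The Lindenbaum–Tarski algebra -/

section Lindenbaum

variable {R : StructRules} {Φ : Set Fm} {φ ψ : Fm}

theorem Derives.cut_singleton {Γ : Multiset Fm} {Θ : Option Fm} (h₁ : Derives R Φ Γ (some φ))
    (h₂ : Derives R Φ {φ} Θ) : Derives R Φ Γ Θ := by
  simpa using h₁.cut (Δ := 0) h₂

theorem Derives.exchange {Γ : Multiset Fm} {Θ : Option Fm}
    (h : Derives R Φ (φ ::ₘ ψ ::ₘ Γ) Θ) : Derives R Φ (ψ ::ₘ φ ::ₘ Γ) Θ := by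
  rwa [Multiset.cons_swap]

theorem derives_fus_iff {Γ : Multiset Fm} {Θ : Option Fm} :
    Derives R Φ (φ.fus ψ ::ₘ Γ) Θ ↔ Derives R Φ (φ ::ₘ ψ ::ₘ Γ) Θ := by
  refine ⟨fun h => ?_, Derives.fusL⟩
  simpa using ((Derives.id φ).fusR (Derives.id ψ)).cut h

theorem derives_impR_iff {Γ : Multiset Fm} :
    Derives R Φ Γ (some (φ.imp ψ)) ↔ Derives R Φ (φ ::ₘ Γ) (some ψ) := by
  refine ⟨fun h => ?_, Derives.impR⟩
  have := h.cut (Δ := {φ}) (by simpa using (Derives.id φ).impL (Δ := 0) (Derives.id ψ))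
  rwa [add_comm, Multiset.singleton_add] at this

theorem derives_one_iff {Θ : Option Fm} : Derives R Φ {Fm.one} Θ ↔ Derives R Φ 0 Θ :=
  ⟨fun h => Derives.oneR.cut_singleton h, fun h => h.oneL⟩

theorem derives_fus_comm (R : StructRules) (Φ : Set Fm) (φ ψ : Fm) :
    Derives R Φ {φ.fus ψ} (some (ψ.fus φ)) :=
  Derives.fusL (Derives.exchange ((Derives.id ψ).fusR (Derives.id φ)))

theorem derives_fus_assoc (R : StructRules) (Φ : Set Fm) (φ ψ χ : Fm) :
    Derives R Φ {(φ.fus ψ).fus χ} (some (φ.fus (ψ.fus χ))) :=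
  Derives.fusL (Derives.fusL ((Derives.id φ).fusR ((Derives.id ψ).fusR (Derives.id χ))))

theorem derives_fus_assoc' (R : StructRules) (Φ : Set Fm) (φ ψ χ : Fm) :
    Derives R Φ {φ.fus (ψ.fus χ)} (some ((φ.fus ψ).fus χ)) := by
  refine Derives.fusL (Derives.exchange (Derives.fusL ?_))
  have h : Derives R Φ ({φ} + {ψ} + {χ}) (some ((φ.fus ψ).fus χ)) :=
    ((Derives.id φ).fusR (Derives.id ψ)).fusR (Derives.id χ)
  rwa [add_assoc, add_comm] at h

theorem Derives.fus_congr {φ' ψ' : Fm} (h₁ : Derives R Φ {φ} (some φ'))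
    (h₂ : Derives R Φ {ψ} (some ψ')) : Derives R Φ {φ.fus ψ} (some (φ'.fus ψ')) :=
  Derives.fusL (h₁.fusR h₂)

theorem Derives.imp_congr {φ' ψ' : Fm} (h₁ : Derives R Φ {φ'} (some φ))
    (h₂ : Derives R Φ {ψ} (some ψ')) : Derives R Φ {φ.imp ψ} (some (φ'.imp ψ')) :=
  Derives.impR (Derives.exchange (by simpa using h₁.impL (Δ := 0) h₂))

theorem derives_one_fus (R : StructRules) (Φ : Set Fm) (φ : Fm) :
    Derives R Φ {Fm.one.fus φ} (some φ) :=
  Derives.fusL (Derives.id φ).oneL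

theorem derives_one_fus' (R : StructRules) (Φ : Set Fm) (φ : Fm) :
    Derives R Φ {φ} (some (Fm.one.fus φ)) := by
  simpa using Derives.oneR.fusR (Derives.id φ)

/-- Formulas preordered by derivability from `Φ`. -/
structure Syntactic (R : StructRules) (Φ : Set Fm) : Type u where
  fm : Fm

instance : Preorder (Syntactic.{u} R Φ) where
  le φ ψ := Derives R Φ {φ.fm} (some ψ.fm)
  le_refl φ := Derives.id φ.fm
  le_trans _ _ _ h₁ h₂ := h₁.cut_singleton h₂

/-- The Lindenbaum–Tarski algebra of the theory axiomatised by `Φ`. -/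
abbrev Lindenbaum (R : StructRules) (Φ : Set Fm) : Type u :=
  Antisymmetrization (Syntactic.{u} R Φ) (· ≤ ·)

namespace Lindenbaum

/-- The class of a formula. -/
def mk (R : StructRules) (Φ : Set Fm) (φ : Fm) : Lindenbaum.{u} R Φ :=
  toAntisymmetrization (· ≤ ·) ⟨φ⟩

theorem mk_le_mk : mk.{u} R Φ φ ≤ mk R Φ ψ ↔ Derives R Φ {φ} (some ψ) := Iff.rfl

theorem mk_surjective : Function.Surjective (mk.{u} R Φ) := fun x => by
  induction x using Quotient.inductionOn' with
  | h x => exact ⟨x.fm, rfl⟩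

/-- The operation on the Lindenbaum–Tarski algebra induced by a congruential connective. -/
def lift₂ (f : Fm → Fm → Fm)
    (hf : ∀ {φ φ' ψ ψ' : Fm}, Derives R Φ {φ} (some φ') → Derives R Φ {φ'} (some φ) →
      Derives R Φ {ψ} (some ψ') → Derives R Φ {ψ'} (some ψ) →
      Derives R Φ {f φ ψ} (some (f φ' ψ'))) :
    Lindenbaum.{u} R Φ → Lindenbaum.{u} R Φ → Lindenbaum.{u} R Φ :=
  Quotient.map₂ (fun φ ψ => ⟨f φ.fm ψ.fm⟩) fun _ _ h₁ _ _ h₂ =>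
    ⟨hf h₁.1 h₁.2 h₂.1 h₂.2, hf h₁.2 h₁.1 h₂.2 h₂.1⟩

/-- On representatives each algebraic law is a rule of the calculus or a short derivation. -/
instance : FLeAlgebra (Lindenbaum.{u} R Φ) where
  inf := lift₂ Fm.and fun h₁ _ h₂ _ => Derives.andR (Derives.andL₁ h₁) (Derives.andL₂ h₂)
  sup := lift₂ Fm.or fun h₁ _ h₂ _ => Derives.orL (Derives.orR₁ h₁) (Derives.orR₂ h₂)
  mul := lift₂ Fm.fus fun h₁ _ h₂ _ => h₁.fus_congr h₂
  res := lift₂ Fm.imp fun _ h₁' h₂ _ => h₁'.imp_congr h₂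
  one := mk R Φ Fm.one
  zero := mk R Φ Fm.zero
  inf_le_left := mk_surjective.forall₂.2 fun φ ψ => Derives.andL₁ (Derives.id φ)
  inf_le_right := mk_surjective.forall₂.2 fun φ ψ => Derives.andL₂ (Derives.id ψ)
  le_inf := mk_surjective.forall₃.2 fun _ _ _ => Derives.andR
  le_sup_left := mk_surjective.forall₂.2 fun φ ψ => Derives.orR₁ (Derives.id φ)
  le_sup_right := mk_surjective.forall₂.2 fun φ ψ => Derives.orR₂ (Derives.id ψ)
  sup_le := mk_surjective.forall₃.2 fun _ _ _ => Derives.orL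
  mul_assoc := mk_surjective.forall₃.2 fun φ ψ χ =>
    le_antisymm (derives_fus_assoc R Φ φ ψ χ) (derives_fus_assoc' R Φ φ ψ χ)
  mul_comm := mk_surjective.forall₂.2 fun φ ψ =>
    le_antisymm (derives_fus_comm R Φ φ ψ) (derives_fus_comm R Φ ψ φ)
  one_mul := mk_surjective.forall.2 fun φ =>
    le_antisymm (derives_one_fus R Φ φ) (derives_one_fus' R Φ φ)
  mul_one := mk_surjective.forall.2 fun φ => le_antisymm
    ((derives_fus_comm R Φ φ Fm.one).cut_singleton (derives_one_fus R Φ φ))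
    ((derives_one_fus' R Φ φ).cut_singleton (derives_fus_comm R Φ Fm.one φ))
  residuation := mk_surjective.forall₃.2 fun φ ψ χ => by
    refine derives_fus_iff.trans (Iff.trans ?_ derives_impR_iff.symm)
    rw [Multiset.cons_swap]; rfl

/-- Valuations in the Lindenbaum–Tarski algebra are substitutions up to interderivability. -/
theorem eval_mk (σ : ℕ → Fm) (φ : Fm) :
    eval (fun n => mk.{u} R Φ (σ n)) φ = mk R Φ (φ.subst σ) := by
  induction φ with
  | var n => rfl
  | and φ ψ ih₁ ih₂ => simp only [eval, ih₁, ih₂]; rfl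
  | or φ ψ ih₁ ih₂ => simp only [eval, ih₁, ih₂]; rfl
  | fus φ ψ ih₁ ih₂ => simp only [eval, ih₁, ih₂]; rfl
  | imp φ ψ ih₁ ih₂ => simp only [eval, ih₁, ih₂]; rfl
  | zero => rfl
  | one => rfl

theorem one_le_mk : 1 ≤ mk.{u} R Φ φ ↔ Derives R Φ 0 (some φ) :=
  mk_le_mk.trans derives_one_iff

end Lindenbaum

end Lindenbaum

/-! ### Substructural logics and their varieties -/

namespace Logic

variable {L : Logic}

theorem entails_mp (hL : L.IsSubstructural) {Φ : Set Fm} {φ ψ : Fm}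
    (h₁ : L.entails Φ (φ.imp ψ)) (h₂ : L.entails Φ φ) : L.entails Φ ψ := by
  obtain ⟨Ax, rfl⟩ := hL
  have h : Derives ⟨False, False, False⟩ (Φ ∪ instances Ax) 0 (some (φ.imp ψ)) := h₁
  exact Derives.cut_singleton h₂ h.mp

theorem thm_subst {φ : Fm} (h : L.Thm φ) (σ : ℕ → Fm) : L.Thm (φ.subst σ) := by
  have h' := L.structural σ h
  rwa [Set.image_empty] at h'

/-- Algebraic completeness. -/
theorem thm_of_forall_inVariety (hL : L.IsSubstructural) {φ : Fm}
    (h : ∀ (A : Type u) [FLeAlgebra A], InVariety L A → ∀ v : ℕ → A, 1 ≤ eval v φ) :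
    L.Thm φ := by
  obtain ⟨Ax, rfl⟩ := hL
  have hV : InVariety (FLe.axExt Ax)
      (Lindenbaum.{u} ⟨False, False, False⟩ (∅ ∪ instances Ax)) := fun φ hφ v => by
    -- Choosing representatives turns `v` into a substitution, under which theorems are closed.
    choose σ hσ using fun n => Lindenbaum.mk_surjective (v n)
    obtain rfl : (fun n => Lindenbaum.mk _ _ (σ n)) = v := funext hσ
    rw [Lindenbaum.eval_mk, Lindenbaum.one_le_mk]
    exact thm_subst hφ σ
  have h' := h _ hV fun n => Lindenbaum.mk _ _ (Fm.var n)
  rwa [Lindenbaum.eval_mk, Lindenbaum.one_le_mk, Fm.subst_var] at h'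

theorem isBounded_of_FLew_le (hL : FLew ≤ L) {A : Type u} [FLeAlgebra A] (hA : InVariety L A) :
    IsBounded A where
  le_one x := one_le_res.1 <| hA ((Fm.var 0).imp Fm.one)
    (hL _ _ (Derives.impR (Derives.weakL trivial Derives.oneR))) fun _ => x
  zero_le x := one_le_res.1 <| hA (Fm.zero.imp (Fm.var 0))
    (hL _ _ (Derives.impR (Derives.weakR trivial Derives.zeroL))) fun _ => x

theorem stronglyConnexive_of_isPseudocomplemented {a : Arrow} (hI : L ≤ IPL)
    (h : ∀ (A : Type u) [FLeAlgebra A], InVariety L A → IsPseudocomplemented A) :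
    StronglyConnexive.{u} L a := by
  -- With `1` on top and `0` at the bottom, `1 ≤ 0` identifies all elements.
  have triv : ∀ (A : Type u) [FLeAlgebra A] [Nontrivial A], InVariety L A → ¬ (1 : A) ≤ 0 := by
    intro A _ _ hA h10
    have hone : ∀ x : A, x = 1 := fun x =>
      le_antisymm ((h A hA).le_one x) (h10.trans ((h A hA).zero_le x))
    obtain ⟨x, y, hxy⟩ := exists_pair_ne A
    exact hxy ((hone x).trans (hone y).symm)
  refine ⟨⟨fun A _ hA => (h A hA).algProtoConnexive a, exists_algNonSymmetric hI a⟩, ?_, ?_⟩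
  · intro A _ _ hA φ
    refine ⟨fun ⟨v, hv⟩ => triv A hA ?_, fun ⟨v, hv⟩ => triv A hA ?_⟩
    · rw [Satisfies, Arrow.eval_fm, eval_neg] at hv
      exact hv.trans ((h A hA).op_neg_le_zero a _)
    · rw [Satisfies, Arrow.eval_fm, eval_neg] at hv
      exact hv.trans ((h A hA).neg_op_le_zero a _)
  · rintro A _ _ hA φ ψ ⟨v, hv₁, hv₂⟩
    rw [Satisfies, Arrow.eval_fm] at hv₁ hv₂
    refine triv A hA (le_trans ?_ ((h A hA).op_mul_op_neg_le a (eval v φ) (eval v ψ)))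
    exact (one_mul 1).symm.le.trans (FLeAlgebra.mul_le_mul hv₁ hv₂)

theorem isPseudocomplemented_of_weaklyConnexive {a : Arrow} (hL : FLew ≤ L)
    (hw : WeaklyConnexive L a) (A : Type u) [FLeAlgebra A] (hA : InVariety L A) :
    IsPseudocomplemented A := by
  refine (isBounded_of_FLew_le hL hA).isPseudocomplemented_of_aristotle a fun x => ?_
  have h := hA _ (hw.aristotle₁ ((Fm.var 0).and (Fm.var 0).neg)) fun _ => x
  rw [eval_neg, Arrow.eval_fm] at h
  exact one_le_neg.1 h

/-- The rule forms of Boethius' theses follow by modus ponens: weakening places `⇒` below `→`, so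
completeness turns each thesis into a provable implication. -/
theorem weaklyConnexive_of_connexive {a : Arrow} (hS : L.IsSubstructural) (hL : FLew ≤ L)
    (hc : Connexive.{u} L a) : WeaklyConnexive L a := by
  have imp : ∀ {φ ψ : Fm}, (∀ (A : Type u) [FLeAlgebra A], InVariety L A → ∀ v : ℕ → A,
      1 ≤ a.op (eval v φ) (eval v ψ)) → L.entails {φ} ψ := by
    intro φ ψ h
    have h' : L.Thm (φ.imp ψ) := thm_of_forall_inVariety.{u} hS fun A _ hA v =>
      (h A hA v).trans ((isBounded_of_FLew_le hL hA).op_le_res a _ _)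
    exact entails_mp hS (L.mono (Set.empty_subset _) h') (L.refl rfl)
  refine ⟨fun φ => ?_, fun φ => ?_, fun φ ψ => ?_, fun φ ψ => ?_⟩
  · refine thm_of_forall_inVariety.{u} hS fun A _ hA v => ?_
    simpa only [eval_neg, Arrow.eval_fm] using (hc.1 A hA).aristotle₁ _
  · refine thm_of_forall_inVariety.{u} hS fun A _ hA v => ?_
    simpa only [eval_neg, Arrow.eval_fm] using (hc.1 A hA).aristotle₂ _
  · refine imp fun A _ hA v => ?_
    simpa only [eval_neg, Arrow.eval_fm] using (hc.1 A hA).boethius₁ _ _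
  · refine imp fun A _ hA v => ?_
    simpa only [eval_neg, Arrow.eval_fm] using (hc.1 A hA).boethius₂ _ _

theorem CPL_thm_noncontradiction (φ : Fm) : CPL.Thm (φ.and φ.neg).neg := by
  refine Derives.impR (Derives.contr trivial (Derives.andL₁ ?_))
  rw [Multiset.cons_swap]
  exact Derives.andL₂ (Derives.zeroR ((Derives.id φ).impL (Δ := 0) Derives.zeroL))

/-- Glivenko's property applied to noncontradiction yields a triple negation of `p ∧ ¬p`, which
collapses to a single one. -/
theorem isPseudocomplemented_of_glivenkoLogic_le (hL : glivenkoLogic FLew CPL ≤ L)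
    (A : Type u) [FLeAlgebra A] (hA : InVariety L A) : IsPseudocomplemented A := by
  obtain ⟨⟨hGS, hG⟩, -⟩ := isLeast_glivenkoFLe_CPL
  obtain ⟨⟨-, hGle, hFLew⟩, -⟩ := isLeast_join hGS (extLogic_isSubstructural ⟨True, True, False⟩)
  refine ⟨isBounded_of_FLew_le (le_trans hFLew hL) hA, fun x => ?_⟩
  have h := hA _ (hL _ _ (hGle _ _ ((hG _).1 (CPL_thm_noncontradiction (Fm.var 0))))) fun _ => x
  exact one_le_neg.1 (h.trans (neg_neg_neg_le _))

end Logic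

end Substructural

/-! ### The main theorem -/

theorem mainTheorem11 (a : Arrow) :
    (∀ L : Logic, L.IsSubstructural → FLew ≤ L → L ≤ IPL →
      (StronglyConnexive.{u} L a ↔ Connexive.{u} L a) ∧
      (Connexive.{u} L a ↔ WeaklyConnexive L a)) ∧
    (∀ L : Logic, L.IsSubstructural → glivenkoLogic FLew CPL ≤ L → L ≤ IPL →
      StronglyConnexive.{u} L a) := by 
  refine ⟨fun L hS hL hI => ?_, fun L _ hL hI =>
    Logic.stronglyConnexive_of_isPseudocomplemented hI
      (Logic.isPseudocomplemented_of_glivenkoLogic_le hL)⟩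
  have hws : WeaklyConnexive L a → StronglyConnexive.{u} L a := fun hw =>
    Logic.stronglyConnexive_of_isPseudocomplemented hI
      (Logic.isPseudocomplemented_of_weaklyConnexive hL hw)
  have hcw : Connexive.{u} L a → WeaklyConnexive L a := Logic.weaklyConnexive_of_connexive hS hL
  exact ⟨⟨And.left, fun hc => hws (hcw hc)⟩, ⟨hcw, fun hw => (hws hw).1⟩⟩
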